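/- Let $\{a,b\}^+$ be the free semigroup of nonempty finite words over $\{a,b\}$, let $\mu$ and $\xi$ be its endomorphisms with $\mu(a)=ab$, $\mu(b)=ba$ and $\xi(a)=b$, $\xi(b)=a$, and let $\mathbf t$ be the Prouhet--Thue--Morse sequence, that is, the infinite word having $\mu^n(a)$ as a prefix for every $n\ge 0$. An endomorphism $\varphi$ of $\{a,b\}^+$ is applied to an infinite word $w=a_1a_2a_3\cdots$ over $\{a,b\}$ by $\varphi(w)=\varphi(a_1)\varphi(a_2)\varphi(a_3)\cdots$. A suffix of $w$ is an infinite word $a_ma_{m+1}a_{m+2}\cdots$ with $m\ge 1$. Let $w$ be an infinite word over $\{a,b\}$ and suppose that there is an endomorphism $\varphi$ of $\{a,b\}^+$ such that $\varphi(w)$ is a suffix of either $\mathbf t$ or $\xi(\mathbf t)$. Then $w$ is itself a suffix of either $\mathbf t$ or $\xi(\mathbf t)$. Consequently, call an infinite word $w$ over $\{a,b\}$ an infinite binary pattern of $\mathbf t$ if there is an endomorphism $\varphi$ of $\{a,b\}^+$ such that $\varphi(w)$ is a suffix of $\mathbf t$. Then the infinite binary patterns of $\mathbf t$ are exactly the suffixes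 of $\mathbf t$ and the suffixes of $\xi(\mathbf t)$. -/

import Mathlib

namespace ThueMorse

/-- The two-letter alphabet `{a, b}`. -/
inductive Letter where
  | a : Letter
  | b : Letter
  deriving DecidableEq

/-- The free semigroup `{a,b}⁺` of finite nonempty words. -/
abbrev Word : Type := FreeSemigroup Letter

/-- Infinite words `a₁a₂⋯` over `{a,b}`; the letters are indexed from `0`. -/
abbrev InfWord : Type := ℕ → Letter

/-- Endomorphisms of the semigroup `{a,b}⁺`. -/
abbrev Endo : Type := Word →ₙ* Word

/-- The list of letters of a finite word. -/
def letters (u : Word) : List Letter := u.head :: u.tail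

theorem length_letters (u : Word) : (letters u).length = u.length := rfl

/-- The endomorphism `μ`, with `μ(a) = ab` and `μ(b) = ba`. -/
def mu : Endo := FreeSemigroup.lift fun x => match x with
  | Letter.a => FreeSemigroup.of Letter.a * FreeSemigroup.of Letter.b
  | Letter.b => FreeSemigroup.of Letter.b * FreeSemigroup.of Letter.a

/-- The endomorphism `ξ` exchanging the letters `a` and `b`. -/
def xi : Endo := FreeSemigroup.lift fun x => match x with
  | Letter.a => FreeSemigroup.of Letter.b
  | Letter.b => FreeSemigroup.of Letter.a

/-- `μⁿ(a)`. -/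
def muPow (n : ℕ) : Word := (mu^[n]) (FreeSemigroup.of Letter.a)

theorem length_mu (u : Word) : (mu u).length = 2 * u.length := by
  induction u using FreeSemigroup.recOnMul with
  | ih1 x => cases x <;> rfl
  | ih2 x y hx hy => rw [map_mul, FreeSemigroup.length_mul, FreeSemigroup.length_mul, hx, hy]; ring

theorem length_muPow (n : ℕ) : (letters (muPow n)).length = 2 ^ n := by
  rw [length_letters]
  induction n with
  | zero => rfl
  | succ n ih => rw [muPow, Function.iterate_succ_apply', length_mu, ← muPow, ih]; ring

/-- The Prouhet-Thue-Morse sequence: the infinite word whose prefix of length `2ⁿ` is `μⁿ(a)`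
(see `tm_prefix`). Its letter of index `n` is that of `μⁿ(a)`, which has length `2ⁿ > n`. -/
def tm : InfWord := fun n =>
  (letters (muPow n))[n]'(by rw [length_muPow]; exact Nat.lt_two_pow_self)

/-- The prefix of length `n + 1` of an infinite word. -/
def pref (w : InfWord) (n : ℕ) : Word := ⟨w 0, List.ofFn fun i : Fin n => w (i + 1)⟩

theorem length_le_length_map (φ : Endo) (u : Word) : u.length ≤ (φ u).length := by
  induction u using FreeSemigroup.recOnMul with
  | ih1 x => rw [FreeSemigroup.length_of]; exact Nat.succ_le_succ (Nat.zero_le _)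
  | ih2 x y hx hy =>
    rw [map_mul, FreeSemigroup.length_mul, FreeSemigroup.length_mul]; exact add_le_add hx hy

theorem lt_length_map_pref (φ : Endo) (w : InfWord) (n : ℕ) :
    n < (letters (φ (pref w n))).length := by
  have h := length_le_length_map φ (pref w n)
  have h' : (pref w n).length = n + 1 := by simp [pref, FreeSemigroup.length]
  rw [length_letters]; omega

/-- The infinite word `φ(w) = φ(a₁)φ(a₂)⋯` for `w = a₁a₂⋯`. Its letter of index `n` is that of
its prefix `φ(a₁⋯aₙ₊₁)`, which has length at least `n + 1` (see `image_prefix`). -/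
def image (φ : Endo) (w : InfWord) : InfWord := fun n =>
  (letters (φ (pref w n)))[n]'(lt_length_map_pref φ w n)

/-- `w` is a suffix of `v`: `v = a₀a₁⋯` and `w = aₘaₘ₊₁⋯` for some `m`. These are the infinite
segments of `v`. -/
def IsSuffix (w v : InfWord) : Prop := ∃ m : ℕ, ∀ n : ℕ, w n = v (m + n)

/-- `w` is an infinite binary pattern of `t`: some endomorphism of `{a,b}⁺` maps `w` to an
infinite segment of `t`. -/
def IsInfinitePattern (w : InfWord) : Prop := ∃ φ : Endo, IsSuffix (image φ w) tm

/-- Each `μⁿ(a)` is a prefix of `μⁿ⁺¹(a)`. -/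
theorem muPow_prefix (n : ℕ) : letters (muPow n) <+: letters (muPow (n + 1)) := by
  have hm : ∀ u v : Word, letters (u * v) = letters u ++ letters v := fun u v => rfl
  have hmu : ∀ m : ℕ, ∃ v : Word, muPow (m + 1) = muPow m * v := by
    intro m
    induction m with
    | zero => exact ⟨FreeSemigroup.of Letter.b, rfl⟩
    | succ m ih =>
      obtain ⟨v, hv⟩ := ih
      refine ⟨mu v, ?_⟩
      have e : ∀ k, muPow (k + 1) = mu (muPow k) := fun k => Function.iterate_succ_apply' _ _ _
      rw [e (m + 1), hv, map_mul, ← hv, ← e m, hv]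
  obtain ⟨v, hv⟩ := hmu n
  rw [hv, hm]; exact List.prefix_append _ _

/-- Each `μⁿ(a)` is a prefix of `t`. -/
theorem tm_prefix (n i : ℕ) (h : i < (letters (muPow n)).length) :
    (letters (muPow n))[i] = tm i := by
  have mono : ∀ k l, k ≤ l → letters (muPow k) <+: letters (muPow l) := fun k l hkl =>
    Nat.le_induction (List.prefix_refl _) (fun l _ ih => ih.trans (muPow_prefix l)) l hkl
  rcases le_total n i with hni | hni
  · exact (mono n i hni).getElem h
  · exact ((mono i n hni).getElem _).symm

/-- Each `φ(a₁⋯aₙ₊₁)` is a prefix of `φ(w)`. -/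
theorem image_prefix (φ : Endo) (w : InfWord) (n i : ℕ)
    (h : i < (letters (φ (pref w n))).length) : (letters (φ (pref w n)))[i] = image φ w i := by
  have hs : ∀ k, letters (φ (pref w k)) <+: letters (φ (pref w (k + 1))) := by
    intro k
    have e : pref w (k + 1) = pref w k * FreeSemigroup.of (w (k + 1)) := by
      refine FreeSemigroup.ext rfl ?_
      simp only [pref, FreeSemigroup.tail_mul, List.ofFn_succ_last]
      rfl
    rw [e, map_mul]; exact List.prefix_append _ _
  have mono : ∀ k l, k ≤ l → letters (φ (pref w k)) <+: letters (φ (pref w l)) := fun k l hkl =>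
    Nat.le_induction (List.prefix_refl _) (fun l _ ih => ih.trans (hs l)) l hkl
  rcases le_total n i with hni | hni
  · exact (mono n i hni).getElem h
  · exact ((mono i n hni).getElem _).symm

end ThueMorse

namespace ThueMorse

/-! Cut the given suffix of t into the blocks φ(w n); exchanging letters reduces ξ(t) to t. An
overlap in w would force one in t, so w is overlap-free and hence contains xx and xyxy for each
ordering of the letters. Their images are squares in t, and a square of odd period in t has an
alternating period, hence of length at most 4. This excludes block lengths of different parity, and
leaves only 1 and 1 when both are odd. If both are even, all cuts have the same parity, and t(2k) =
t(k), t(2k+1) = ξ(t(k)) let the parsing be halved. By descent every block becomes a single letter,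
so w is a suffix of t up to renaming letters. -/

/-- The exchange of the two letters. -/
def Letter.swap : Letter → Letter
  | a => b
  | b => a

theorem Letter.ne_iff_eq_swap {x y : Letter} : x ≠ y ↔ x = y.swap := by
  cases x <;> cases y <;> simp [Letter.swap]

theorem Letter.swap_swap (x : Letter) : x.swap.swap = x := by cases x <;> rfl

theorem Letter.swap_injective : Function.Injective Letter.swap :=
  Function.LeftInverse.injective Letter.swap_swap

/-! ### Letterwise description of μ, ξ and t -/

theorem letters_mul (u v : Word) : letters (u * v) = letters u ++ letters v := rfl

theorem letters_mu (u : Word) : letters (mu u) = (letters u).flatMap fun x => [x, x.swap] := by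
  induction u using FreeSemigroup.recOnMul with
  | ih1 x => cases x <;> rfl
  | ih2 x y hx hy => rw [map_mul, letters_mul, hx, hy, letters_mul, List.flatMap_append]

theorem letters_xi (u : Word) : letters (xi u) = (letters u).map Letter.swap := by
  induction u using FreeSemigroup.recOnMul with
  | ih1 x => cases x <;> rfl
  | ih2 x y hx hy => rw [map_mul, letters_mul, hx, hy, letters_mul, List.map_append]

theorem getElem?_flatMap_pair {α : Type*} (f g : α → α) (l : List α) (i : ℕ) :
    (l.flatMap fun x => [f x, g x])[2 * i]? = l[i]?.map f ∧
      (l.flatMap fun x => [f x, g x])[2 * i + 1]? = l[i]?.map g := by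
  induction l generalizing i with
  | nil => simp
  | cons x l ih =>
    cases i with
    | zero => simp
    | succ i => simpa [Nat.mul_add] using ih i

theorem getElem?_muPow {n i : ℕ} (h : i < 2 ^ n) : (letters (muPow n))[i]? = some (tm i) := by
  have h' : i < (letters (muPow n)).length := by rwa [length_muPow]
  rw [List.getElem?_eq_getElem h', tm_prefix]

theorem letters_muPow_succ (n : ℕ) :
    letters (muPow (n + 1)) = (letters (muPow n)).flatMap fun x => [x, x.swap] := by
  rw [← letters_mu, muPow, Function.iterate_succ_apply', ← muPow]

theorem tm_two_mul (n : ℕ) : tm (2 * n) = tm n := by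
  have hn : n < 2 ^ n := Nat.lt_two_pow_self
  have h := (getElem?_flatMap_pair (fun x => x) Letter.swap (letters (muPow n)) n).1
  rw [← letters_muPow_succ, getElem?_muPow hn, getElem?_muPow (by rw [pow_succ]; omega)] at h
  simpa using h

theorem tm_two_mul_add_one (n : ℕ) : tm (2 * n + 1) = (tm n).swap := by
  have hn : n < 2 ^ n := Nat.lt_two_pow_self
  have h := (getElem?_flatMap_pair (fun x => x) Letter.swap (letters (muPow n)) n).2
  rw [← letters_muPow_succ, getElem?_muPow hn, getElem?_muPow (by rw [pow_succ]; omega)] at h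
  simpa using h

theorem tm_ne_succ {i : ℕ} (h : Even i) : tm (i + 1) ≠ tm i := by
  obtain ⟨k, rfl⟩ := h
  rw [← two_mul, Letter.ne_iff_eq_swap, tm_two_mul_add_one, tm_two_mul]

theorem pref_succ (w : InfWord) (n : ℕ) :
    pref w (n + 1) = pref w n * FreeSemigroup.of (w (n + 1)) := by
  refine FreeSemigroup.ext rfl ?_
  simp only [pref, FreeSemigroup.tail_mul, List.ofFn_succ_last]
  rfl

theorem letters_pref (w : InfWord) (n : ℕ) :
    letters (pref w n) = List.ofFn fun i : Fin (n + 1) => w i := by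
  simp [letters, pref, List.ofFn_succ]

theorem image_xi (w : InfWord) (n : ℕ) : image xi w n = (w n).swap := by
  simp [image, letters_xi, letters_pref, -List.ofFn_succ]

theorem image_id (w : InfWord) : image (MulHom.id Word) w = w := by
  funext n
  simp [image, letters_pref, -List.ofFn_succ]

/-! ### Overlaps and odd squares in t -/

/-- `w` contains the overlap of period `q` that starts at position `s`. -/
def OverlapAt (w : InfWord) (s q : ℕ) : Prop := 0 < q ∧ ∀ i ≤ q, w (s + i) = w (s + q + i)

/-- `w` contains no factor of the form `cvcvc` with `c` a letter. -/
def OverlapFree (w : InfWord) : Prop := ∀ s q, ¬ OverlapAt w s q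

/-- The first block of a square of odd period in `t` is alternating. -/
theorem tm_alternating_of_odd_period {s q n : ℕ} (hq : Odd q)
    (h : ∀ i < n, tm (s + i) = tm (s + q + i)) {i : ℕ} (hi : i + 1 < n) :
    tm (s + i + 1) ≠ tm (s + i) := by
  rcases Nat.even_or_odd (s + i) with he | ho
  · exact tm_ne_succ he
  -- The odd period moves the pair to an even position, where neighbours differ.
  · rw [add_assoc, h i (by omega), h (i + 1) hi, ← add_assoc]
    refine tm_ne_succ ?_
    rw [add_right_comm]
    exact ho.add_odd hq

theorem eq_iff_even_of_alternating {w : InfWord} {s n : ℕ}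
    (h : ∀ i, i + 1 < n → w (s + i + 1) ≠ w (s + i)) {i : ℕ} (hi : i < n) :
    w (s + i) = w s ↔ Even i := by
  induction i with
  | zero => simp
  | succ i ih =>
    have h1 := h i hi
    have h2 := ih (by omega)
    rw [Nat.even_add_one, ← h2, ← add_assoc]
    revert h1
    cases w (s + i + 1) <;> cases w (s + i) <;> cases w s <;> simp

/-- Descent on the period: an even one halves by reading every second letter; an odd one makes the
first q + 1 letters alternate, so letters at distance q differ. -/
theorem overlapFree_tm : OverlapFree tm := by
  intro s q
  induction q using Nat.strong_induction_on generalizing s with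
  | _ q ih =>
    rintro ⟨hq, h⟩
    rcases Nat.even_or_odd q with he | ho
    · obtain ⟨r, rfl⟩ := he
      refine ih r (by omega) (s / 2) ⟨by omega, fun i hi => ?_⟩
      have h1 := h (2 * i) (by omega)
      rcases Nat.even_or_odd' s with ⟨k, rfl | rfl⟩
      · rw [show 2 * k + 2 * i = 2 * (k + i) by ring,
          show 2 * k + (r + r) + 2 * i = 2 * (k + r + i) by ring, tm_two_mul, tm_two_mul] at h1
        rwa [show 2 * k / 2 = k by omega]
      · rw [show 2 * k + 1 + 2 * i = 2 * (k + i) + 1 by ring,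
          show 2 * k + 1 + (r + r) + 2 * i = 2 * (k + r + i) + 1 by ring,
          tm_two_mul_add_one, tm_two_mul_add_one] at h1
        rw [show (2 * k + 1) / 2 = k by omega]
        exact Letter.swap_injective h1
    · have := eq_iff_even_of_alternating (w := tm) (s := s) (n := q + 1)
        (fun i hi => tm_alternating_of_odd_period ho (fun i hi => h i (by omega)) hi)
        (Nat.lt_succ_self q)
      exact Nat.not_even_iff_odd.2 ho (this.1 (h 0 (by omega)).symm)

/-- An alternating factor of `t` has length at most four. -/
theorem tm_alternating_length_le {s n : ℕ}
    (h : ∀ i, i + 1 < n → tm (s + i + 1) ≠ tm (s + i)) : n ≤ 4 := by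
  by_contra! hn
  refine overlapFree_tm s 2 ⟨by omega, fun i hi => ?_⟩
  have h1 := h i (by omega)
  have h2 := h (i + 1) (by omega)
  rw [show s + 2 + i = s + (i + 1) + 1 by ring]
  revert h1 h2
  rw [← add_assoc]
  cases tm (s + i + 1 + 1) <;> cases tm (s + i + 1) <;> cases tm (s + i) <;> simp

theorem tm_no_cube (s : ℕ) : ¬(tm s = tm (s + 1) ∧ tm (s + 1) = tm (s + 2)) :=
  fun h => overlapFree_tm s 1 ⟨by omega, fun i hi => by interval_cases i; exacts [h.1, h.2]⟩

theorem tm_no_overlap_two (s : ℕ) :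
    ¬(tm s = tm (s + 2) ∧ tm (s + 1) = tm (s + 3) ∧ tm (s + 2) = tm (s + 4)) :=
  fun h => overlapFree_tm s 2
    ⟨by omega, fun i hi => by interval_cases i; exacts [h.1, h.2.1, h.2.2]⟩

theorem tm_no_overlap_three (s : ℕ) :
    ¬(tm s = tm (s + 3) ∧ tm (s + 1) = tm (s + 4) ∧ tm (s + 2) = tm (s + 5) ∧
      tm (s + 3) = tm (s + 6)) :=
  fun h => overlapFree_tm s 3
    ⟨by omega, fun i hi => by interval_cases i; exacts [h.1, h.2.1, h.2.2.1, h.2.2.2]⟩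

/-! ### Factors forced in overlap-free words -/

/-- The prefix of length `n`, read backwards. -/
def revPrefix (w : InfWord) : ℕ → List Letter
  | 0 => []
  | n + 1 => w n :: revPrefix w n

theorem length_revPrefix (w : InfWord) (n : ℕ) : (revPrefix w n).length = n := by
  induction n with
  | zero => rfl
  | succ n ih => simp [revPrefix, ih]

theorem getElem_revPrefix (w : InfWord) (n i : ℕ) (h : i < (revPrefix w n).length) :
    (revPrefix w n)[i] = w (n - 1 - i) := by
  induction n generalizing i with
  | zero => simp [revPrefix] at h
  | succ n ih =>
    cases i with
    | zero => simp [revPrefix]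
    | succ i =>
      simp only [revPrefix, List.getElem_cons_succ, ih]
      congr 1
      omega

/-- The list starts with an overlap of period at most six. -/
def startsWithOverlap (l : List Letter) : Bool :=
  (List.range 6).any fun q =>
    -- The period is `q + 1`.
    decide (2 * q + 3 ≤ l.length) && ((l.drop (q + 1)).take (q + 2)).isPrefixOf l

/-- Every extension of `l` to the left by `k` letters passes through a list that starts with an
overlap or with `r`. -/
def isForced (r : List Letter) : ℕ → List Letter → Bool
  | 0, _ => false
  | k + 1, l => startsWithOverlap l || r.isPrefixOf l ||
      (isForced r k (Letter.a :: l) && isForced r k (Letter.b :: l))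

theorem OverlapFree.startsWithOverlap_eq_false {w : InfWord} (hw : OverlapFree w) (n : ℕ) :
    startsWithOverlap (revPrefix w n) = false := by
  by_contra h
  simp only [startsWithOverlap, Bool.not_eq_false, List.any_eq_true, Bool.and_eq_true,
    decide_eq_true_eq, List.isPrefixOf_iff_prefix, length_revPrefix] at h
  obtain ⟨q, -, hn, hp⟩ := h
  refine hw (n - 1 - 2 * (q + 1)) (q + 1) ⟨by omega, fun i hi => ?_⟩
  have h1 := hp.getElem (i := q + 1 - i) (by simp [length_revPrefix]; omega)
  simp only [List.getElem_take, List.getElem_drop, getElem_revPrefix] at h1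
  convert h1 using 2 <;> omega

/-- The prefixes of `w` follow one branch of the search tree; it never meets an overlap, so it meets
`r`. Prefixes are read backwards, so the factor is `r` reversed. -/
theorem OverlapFree.exists_factor {w : InfWord} (hw : OverlapFree w) {r : List Letter} {k : ℕ}
    (h : isForced r k [] = true) :
    ∃ s, ∀ i (hi : i < r.length), w (s + i) = r[r.length - 1 - i] := by
  have key : ∀ k n, isForced r k (revPrefix w n) = true → ∃ m, r <+: revPrefix w m := by
    intro k
    induction k with
    | zero => intro n h; simp [isForced] at h
    | succ k ih =>
      intro n h
      simp only [isForced, hw.startsWithOverlap_eq_false, Bool.false_or, Bool.or_eq_true,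
        Bool.and_eq_true, List.isPrefixOf_iff_prefix] at h
      rcases h with h | ⟨ha, hb⟩
      · exact ⟨n, h⟩
      · refine ih (n + 1) ?_
        rw [revPrefix]
        cases w n <;> assumption
  obtain ⟨m, hm⟩ := key k 0 h
  have hl := hm.length_le
  rw [length_revPrefix] at hl
  refine ⟨m - r.length, fun i hi => ?_⟩
  rw [hm.getElem, getElem_revPrefix]
  congr 1
  omega

theorem OverlapFree.exists_square {w : InfWord} (hw : OverlapFree w) (x : Letter) :
    ∃ s, w s = x ∧ w (s + 1) = x := by
  have h : isForced [x, x] 10 [] = true := by cases x <;> decide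
  obtain ⟨s, hs⟩ := hw.exists_factor h
  exact ⟨s, hs 0 (by simp), hs 1 (by simp)⟩

theorem OverlapFree.exists_alternating {w : InfWord} (hw : OverlapFree w) (x : Letter) :
    ∃ s, w s = x ∧ w (s + 1) = x.swap ∧ w (s + 2) = x ∧ w (s + 3) = x.swap := by
  -- A finite check: with fuel 22, words of length up to 21 are searched.
  have h : isForced [x.swap, x, x.swap, x] 22 [] = true := by cases x <;> decide
  obtain ⟨s, hs⟩ := hw.exists_factor h
  exact ⟨s, hs 0 (by simp), hs 1 (by simp), hs 2 (by simp), hs 3 (by simp)⟩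

/-! ### Parsings of suffixes of `t` -/

/-- The positions `p 0 < p 1 < ⋯` cut a suffix of `t` into blocks; the block of index `n` is
determined by the letter `w n`, and has length `L (w n)`. -/
structure IsParsing (w : InfWord) (L : Letter → ℕ) (p : ℕ → ℕ) : Prop where
  pos : ∀ x, 0 < L x
  succ : ∀ n, p (n + 1) = p n + L (w n)
  block : ∀ n k, w n = w k → ∀ j < L (w n), tm (p n + j) = tm (p k + j)

namespace IsParsing

variable {w : InfWord} {L : Letter → ℕ} {p : ℕ → ℕ}

theorem le_add (h : IsParsing w L p) (s n : ℕ) : p s + n ≤ p (s + n) := by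
  induction n with
  | zero => exact le_rfl
  | succ n ih =>
    have h1 := h.succ (s + n)
    have h2 := h.pos (w (s + n))
    rw [← add_assoc s]
    omega

theorem transport (h : IsParsing w L p) {s s' n : ℕ} (hn : ∀ i < n, w (s + i) = w (s' + i)) :
    p (s + n) + p s' = p (s' + n) + p s ∧
      ∀ x, p s + x < p (s + n) → tm (p s + x) = tm (p s' + x) := by
  induction n with
  | zero => exact ⟨add_comm _ _, fun x hx => by simp at hx⟩
  | succ n ih =>
    obtain ⟨h1, h2⟩ := ih fun i hi => hn i (by omega)
    have e := hn n (by omega)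
    have h3 := h.succ (s + n)
    have h4 := h.succ (s' + n)
    have h5 := h.le_add s n
    rw [← e] at h4
    rw [← add_assoc s, ← add_assoc s']
    refine ⟨by omega, fun x hx => ?_⟩
    rcases lt_or_ge (p s + x) (p (s + n)) with hlt | hge
    · exact h2 x hlt
    · have h6 := h.block _ _ e (p s + x - p (s + n)) (by omega)
      convert h6 using 2 <;> omega

/-- The image of cvcvc contains an overlap: the first letter of the last block suffices. -/
theorem overlapFree (h : IsParsing w L p) : OverlapFree w := by
  rintro s q ⟨hq, ho⟩
  obtain ⟨-, h2⟩ := h.transport (n := q + 1) (s := s) (s' := s + q) fun i hi => ho i (by omega)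
  have h3 := h.le_add s q
  have h4 := h.le_add (s + q) 1
  refine overlapFree_tm (p s) (p (s + q) - p s) ⟨by omega, fun i hi => ?_⟩
  rw [h2 i (by rw [← add_assoc]; omega)]
  congr 1
  omega

/-- A square of odd period in `t` that is made of two equal runs of blocks is short and its period
is alternating. -/
theorem alternating_of_odd (h : IsParsing w L p) {s n q : ℕ} (hp : p (s + n) = p s + q)
    (hq : Odd q) (hw : ∀ i < n, w (s + i) = w (s + n + i)) :
    q ≤ 4 ∧ ∀ i, i + 1 < q → tm (p s + i + 1) ≠ tm (p s + i) := by
  have h1 := (h.transport hw).2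
  have h2 : ∀ i, i + 1 < q → tm (p s + i + 1) ≠ tm (p s + i) := fun i hi =>
    tm_alternating_of_odd_period hq (n := q)
      (fun j hj => by rw [h1 j (by omega), hp]) hi
  exact ⟨tm_alternating_length_le h2, h2⟩

/-- The letter occurs doubled somewhere in `w`, giving a square of odd period in t; all its blocks
are equal. -/
theorem alternating_block (h : IsParsing w L p) {n : ℕ} (ho : Odd (L (w n))) :
    L (w n) ≤ 4 ∧ ∀ i, i + 1 < L (w n) → tm (p n + i + 1) ≠ tm (p n + i) := by
  obtain ⟨s, hs, hs1⟩ := h.overlapFree.exists_square (w n)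
  have h1 := h.alternating_of_odd (s := s) (n := 1) (h.succ s) (by rwa [hs])
    (fun i hi => by obtain rfl : i = 0 := by omega
                    exact hs.trans hs1.symm)
  rw [hs] at h1
  refine ⟨h1.1, fun i hi => ?_⟩
  rw [add_assoc, h.block n s hs.symm i (by omega), h.block n s hs.symm (i + 1) hi, ← add_assoc]
  exact h1.2 i hi

/-- Otherwise xyxy and yxyx give squares of odd period at most 4, so the lengths are 1 and 2.
Alternation of the first gives blocks u and vu; then vuu does not alternate. -/
theorem odd_swap (h : IsParsing w L p) {x : Letter} (hx : Odd (L x)) : Odd (L x.swap) := by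
  by_contra he
  rw [Nat.not_odd_iff_even] at he
  obtain ⟨s, a0, a1, a2, a3⟩ := h.overlapFree.exists_alternating x
  obtain ⟨r, b0, b1, b2, b3⟩ := h.overlapFree.exists_alternating x.swap
  rw [Letter.swap_swap] at b1 b3
  have ps := h.succ s
  have ps1 := h.succ (s + 1)
  have pr := h.succ r
  have pr1 := h.succ (r + 1)
  rw [a0] at ps
  rw [a1] at ps1
  rw [b0] at pr
  rw [b1] at pr1
  have ho : Odd (L x + L x.swap) := hx.add_even he
  obtain ⟨hl, hs⟩ := h.alternating_of_odd (s := s) (n := 2) (q := L x + L x.swap)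
    (by rw [ps1, ps]; ring) ho
    (fun i hi => by interval_cases i <;> simp_all)
  obtain ⟨-, hr⟩ := h.alternating_of_odd (s := r) (n := 2) (q := L x + L x.swap)
    (by rw [pr1, pr]; ring) ho
    (fun i hi => by interval_cases i <;> simp_all)
  have hpos := h.pos x.swap
  have hLx : L x = 1 := by
    obtain ⟨i, hi⟩ := hx
    obtain ⟨j, hj⟩ := he
    omega
  have hLy : L x.swap = 2 := by
    obtain ⟨j, hj⟩ := he
    omega
  have c0 := h.block (s + 1) r (a1.trans b0.symm) 1 (by rw [a1]; omega)
  have c1 := h.block s (r + 1) (a0.trans b1.symm) 0 (by rw [a0]; omega)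
  have d0 := hs 0 (by omega)
  have d1 := hs 1 (by omega)
  have d2 := hr 1 (by omega)
  rw [ps, hLx] at c0
  rw [pr, hLy] at c1
  simp only [add_zero, add_assoc, Nat.reduceAdd] at c0 c1 d0 d1 d2
  revert c0 c1 d0 d1 d2
  generalize tm (p s) = x0, tm (p s + 1) = x1, tm (p s + 2) = x2, tm (p r + 1) = y1,
    tm (p r + 2) = y2
  cases x0 <;> cases x1 <;> cases x2 <;> cases y1 <;> cases y2 <;> simp

/-- Odd blocks are alternating of length 1 or 3. In the image of abab, a block of length 3 forces a
cube or an overlap of period 2 or 3; equal blocks of length 1 give a cube. -/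
theorem length_eq_one_of_odd (h : IsParsing w L p) (ha : Odd (L Letter.a)) (hb : Odd (L Letter.b)) :
    L Letter.a = 1 ∧ L Letter.b = 1 ∧
      ∀ n k, w n = Letter.a → w k = Letter.b → tm (p n) ≠ tm (p k) := by
  obtain ⟨s, a0, a1, a2, a3⟩ := h.overlapFree.exists_alternating Letter.a
  simp only [Letter.swap] at a1 a3
  have p1 := h.succ s
  have p2 := h.succ (s + 1)
  have p3 := h.succ (s + 2)
  have alt0 := h.alternating_block (n := s) (by rwa [a0])
  have alt1 := h.alternating_block (n := s + 1) (by rwa [a1])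
  have b2 := h.block s (s + 2) (a0.trans a2.symm)
  have b3 := h.block (s + 1) (s + 3) (a1.trans a3.symm)
  rw [a0] at p1 alt0 b2
  rw [a1] at p2 alt1 b3
  rw [a2] at p3
  have hlen : ∀ j, Odd j → j ≤ 4 → j = 1 ∨ j = 3 := by
    rintro j ⟨i, rfl⟩ h
    omega
  have o1 := tm_no_cube
  have o2 := tm_no_overlap_two (p s)
  have o3 := tm_no_overlap_three (p s)
  rcases hlen _ ha alt0.1 with hA | hA <;> rcases hlen _ hb alt1.1 with hB | hB
  · refine ⟨hA, hB, fun n k hn hk => ?_⟩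
    have c0 := h.block n s (hn.trans a0.symm) 0 (h.pos _)
    have c1 := h.block k (s + 1) (hk.trans a1.symm) 0 (h.pos _)
    have d0 := b2 0 (h.pos _)
    have o := o1 (p s)
    simp only [p1, p2, hA, hB, add_assoc, Nat.reduceAdd, add_zero] at c0 c1 d0
    rw [c0, c1]
    intro e
    exact o ⟨e, e.symm.trans d0⟩
  · exfalso
    have d0 := b2 0 (by omega)
    have d1 := b3 0 (by omega)
    have e0 := alt1.2 0 (by omega)
    have e1 := alt1.2 1 (by omega)
    have o := o1 (p s + 3)
    simp only [p1, p2, p3, hA, hB, add_assoc, Nat.reduceAdd, add_zero] at d0 d1 e0 e1 o o2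
    revert d0 d1 e0 e1 o o2
    generalize tm (p s) = x0, tm (p s + 1) = x1, tm (p s + 2) = x2, tm (p s + 3) = x3,
      tm (p s + 4) = x4, tm (p s + 5) = x5
    rintro o2 rfl rfl
    revert o2
    cases x0 <;> cases x1 <;> cases x2 <;> cases x3 <;> simp
  · exfalso
    have d0 := b2 0 (by omega)
    have e0 := alt0.2 0 (by omega)
    have e1 := alt0.2 1 (by omega)
    have o := o1 (p s + 2)
    simp only [p1, p2, hA, hB, add_assoc, Nat.reduceAdd, add_zero] at d0 e0 e1 o o2
    revert d0 e0 e1 o o2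
    generalize tm (p s) = x0, tm (p s + 1) = x1, tm (p s + 2) = x2, tm (p s + 3) = x3,
      tm (p s + 4) = x4
    rintro o2 rfl
    revert o2
    cases x0 <;> cases x1 <;> cases x2 <;> cases x3 <;> simp
  · exfalso
    have d0 := b2 0 (by omega)
    have e0 := alt0.2 0 (by omega)
    have e1 := alt0.2 1 (by omega)
    have f0 := alt1.2 0 (by omega)
    have f1 := alt1.2 1 (by omega)
    simp only [p1, p2, hA, hB, add_assoc, Nat.reduceAdd, add_zero] at d0 e0 e1 f0 f1 o3 o2
    revert d0 e0 e1 f0 f1 o2 o3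
    generalize tm (p s) = x0, tm (p s + 1) = x1, tm (p s + 2) = x2, tm (p s + 3) = x3,
      tm (p s + 4) = x4, tm (p s + 5) = x5, tm (p s + 6) = x6
    rintro o2 o3 rfl
    revert o2 o3
    cases x0 <;> cases x1 <;> cases x2 <;> cases x3 <;> cases x4 <;> cases x5 <;> simp

/-- All cuts have the parity of `p 0`, so every second letter from a cut comes from t itself or from
its exchange. -/
theorem half (h : IsParsing w L p) (ha : Even (L Letter.a)) (hb : Even (L Letter.b)) :
    IsParsing w (fun x => L x / 2) (fun n => p n / 2) := by
  have he : ∀ x, L x / 2 + L x / 2 = L x := by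
    rintro (_ | _)
    · obtain ⟨k, hk⟩ := ha; omega
    · obtain ⟨k, hk⟩ := hb; omega
  have hmod : ∀ n, p n % 2 = p 0 % 2 := by
    intro n
    induction n with
    | zero => rfl
    | succ n ih =>
      have h1 := h.succ n
      have h2 := he (w n)
      omega
  refine ⟨fun x => ?_, fun n => ?_, fun n k e j hj => ?_⟩
  · have h1 := h.pos x
    have h2 := he x
    omega
  · have h1 := h.succ n
    have h2 := he (w n)
    omega
  · have h1 := h.block n k e (2 * j) (by omega)
    have hn := hmod n
    have hk := hmod k
    rcases Nat.mod_two_eq_zero_or_one (p 0) with h0 | h0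
    · rwa [show p n + 2 * j = 2 * (p n / 2 + j) by omega,
        show p k + 2 * j = 2 * (p k / 2 + j) by omega, tm_two_mul, tm_two_mul] at h1
    · rw [show p n + 2 * j = 2 * (p n / 2 + j) + 1 by omega,
        show p k + 2 * j = 2 * (p k / 2 + j) + 1 by omega,
        tm_two_mul_add_one, tm_two_mul_add_one] at h1
      exact Letter.swap_injective h1

theorem isSuffix_of_length_eq_one (h : IsParsing w L p) (hL : ∀ x, L x = 1)
    (hne : ∀ n k, w n = Letter.a → w k = Letter.b → tm (p n) ≠ tm (p k)) :
    IsSuffix w tm ∨ IsSuffix w (image xi tm) := by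
  have hp : ∀ n, p n = p 0 + n := by
    intro n
    induction n with
    | zero => rfl
    | succ n ih => rw [h.succ, hL, ih, add_assoc]
  obtain ⟨r, hr, -⟩ := h.overlapFree.exists_square Letter.a
  have key : ∀ n, w n = Letter.a ↔ tm (p n) = tm (p r) := by
    intro n
    constructor
    · intro hn
      exact h.block n r (hn.trans hr.symm) 0 (h.pos _)
    · intro hn
      cases hwn : w n with
      | a => rfl
      | b => exact absurd hn.symm (hne r n hr hwn)
  cases hx : tm (p r) with
  | a =>
    refine Or.inl ⟨p 0, fun n => ?_⟩
    have := key n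
    rw [hp n, hx] at this
    revert this
    cases w n <;> cases tm (p 0 + n) <;> simp
  | b =>
    refine Or.inr ⟨p 0, fun n => ?_⟩
    have := key n
    rw [hp n, hx] at this
    rw [image_xi]
    revert this
    cases w n <;> cases tm (p 0 + n) <;> simp [Letter.swap]

theorem isSuffix (h : IsParsing w L p) : IsSuffix w tm ∨ IsSuffix w (image xi tm) := by
  induction hN : L Letter.a + L Letter.b using Nat.strong_induction_on generalizing L p with
  | _ N ih =>
    rcases Nat.even_or_odd (L Letter.a) with ha | ha
    · have hb : Even (L Letter.b) := by
        by_contra hb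
        exact Nat.not_odd_iff_even.2 ha (h.odd_swap (x := Letter.b) (Nat.not_even_iff_odd.1 hb))
      have h1 := h.pos Letter.a
      exact ih _ (by omega) (h.half ha hb) rfl
    · obtain ⟨h1, h2, h3⟩ := h.length_eq_one_of_odd ha (h.odd_swap ha)
      exact h.isSuffix_of_length_eq_one (by rintro (_ | _) <;> assumption) h3

end IsParsing

/-! ### From endomorphisms to parsings -/

theorem getElem?_image (φ : Endo) (w : InfWord) {n i : ℕ}
    (h : i < (letters (φ (pref w n))).length) :
    (letters (φ (pref w n)))[i]? = some (image φ w i) := by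
  rw [List.getElem?_eq_getElem h, image_prefix]

/-- The image `φ(w)` is cut into the words `φ(w n)`. -/
theorem exists_cut_image (φ : Endo) (w : InfWord) : ∃ c : ℕ → ℕ, ∀ n,
    c (n + 1) = c n + (letters (φ (FreeSemigroup.of (w n)))).length ∧
      ∀ j (hj : j < (letters (φ (FreeSemigroup.of (w n)))).length),
        image φ w (c n + j) = (letters (φ (FreeSemigroup.of (w n))))[j] := by
  -- `pref w k` has k + 1 letters, so its image ends at cut k + 1.
  refine ⟨fun n => n.casesOn 0 fun k => (letters (φ (pref w k))).length, fun n => ?_⟩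
  cases n with
  | zero =>
    refine ⟨(zero_add _).symm, fun j hj => ?_⟩
    change image φ w (0 + j) = _
    rw [zero_add]
    exact (image_prefix φ w 0 j hj).symm
  | succ k =>
    have e : letters (φ (pref w (k + 1))) =
        letters (φ (pref w k)) ++ letters (φ (FreeSemigroup.of (w (k + 1)))) := by
      rw [pref_succ, map_mul, letters_mul]
    refine ⟨by simp only [e, List.length_append], fun j hj => ?_⟩
    have h1 := getElem?_image φ w (n := k + 1) (i := (letters (φ (pref w k))).length + j)
      (by rw [e, List.length_append]; omega)
    rw [e, List.getElem?_append_right (by omega), Nat.add_sub_cancel_left,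
      List.getElem?_eq_getElem hj] at h1
    exact (Option.some.inj h1).symm

/-- The map `f` treats t (identity) and ξ(t) (exchange) together. -/
theorem isSuffix_of_image {φ : Endo} {w : InfWord} {f : Letter → Letter} {m : ℕ}
    (h : ∀ n, tm (m + n) = f (image φ w n)) :
    IsSuffix w tm ∨ IsSuffix w (image xi tm) := by
  obtain ⟨c, hc⟩ := exists_cut_image φ w
  refine IsParsing.isSuffix (L := fun x => (letters (φ (FreeSemigroup.of x))).length)
    (p := fun n => m + c n) ⟨fun x => Nat.succ_pos _, fun n => ?_, fun n k e j hj => ?_⟩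
  · simp only [(hc n).1, add_assoc]
  · simp only [add_assoc, h]
    rw [(hc n).2 j hj, (hc k).2 j (by rwa [← e])]
    simp only [e]

end ThueMorse

theorem mainTheorem4 :
    (∀ w : ThueMorse.InfWord,
      (∃ φ : ThueMorse.Endo,
        ThueMorse.IsSuffix (ThueMorse.image φ w) ThueMorse.tm ∨
        ThueMorse.IsSuffix (ThueMorse.image φ w) (ThueMorse.image ThueMorse.xi ThueMorse.tm)) →
      ThueMorse.IsSuffix w ThueMorse.tm ∨
        ThueMorse.IsSuffix w (ThueMorse.image ThueMorse.xi ThueMorse.tm)) ∧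
    (∀ w : ThueMorse.InfWord,
      ThueMorse.IsInfinitePattern w ↔
        ThueMorse.IsSuffix w ThueMorse.tm ∨
          ThueMorse.IsSuffix w (ThueMorse.image ThueMorse.xi ThueMorse.tm)) := by
  have key : ∀ w : ThueMorse.InfWord,
      (∃ φ : ThueMorse.Endo,
        ThueMorse.IsSuffix (ThueMorse.image φ w) ThueMorse.tm ∨
        ThueMorse.IsSuffix (ThueMorse.image φ w) (ThueMorse.image ThueMorse.xi ThueMorse.tm)) →
      ThueMorse.IsSuffix w ThueMorse.tm ∨
        ThueMorse.IsSuffix w (ThueMorse.image ThueMorse.xi ThueMorse.tm) := by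
    rintro w ⟨φ, ⟨m, hm⟩ | ⟨m, hm⟩⟩
    · exact ThueMorse.isSuffix_of_image (f := id) fun n => (hm n).symm
    · refine ThueMorse.isSuffix_of_image (φ := φ) (f := ThueMorse.Letter.swap) (m := m) fun n => ?_
      rw [hm n, ThueMorse.image_xi, ThueMorse.Letter.swap_swap]
  refine ⟨key, fun w => ⟨fun ⟨φ, hφ⟩ => key w ⟨φ, Or.inl hφ⟩, ?_⟩⟩
  rintro (hw | ⟨m, hm⟩)
  · exact ⟨MulHom.id ThueMorse.Word, by rwa [ThueMorse.image_id]⟩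
  · refine ⟨ThueMorse.xi, m, fun n => ?_⟩
    rw [ThueMorse.image_xi, hm n, ThueMorse.image_xi, ThueMorse.Letter.swap_swap]
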